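/- For $d>0$ let $\sigma_d(y)=\frac{1}{\sqrt{4\pi d}}\,e^{-y^2/4d}$ be a time-independent Gaussian density on the $x$-axis of $\mathbb{R}^2$. For $0<\epsilon^2\le \Delta t$ and a target point $\mathbf{x}=(x,0)$, let $$S^{\epsilon}[\sigma_d](\mathbf{x},\Delta t)=\int_0^{\Delta t-\epsilon^2}\Phi(\tau)\,d\tau,\qquad \Phi(\tau)=\int_{-\infty}^{\infty}\frac{1}{4\pi(\Delta t-\tau)}\,e^{-\frac{(x-y)^2}{4(\Delta t-\tau)}}\,\sigma_d(y)\,dy,$$ be the single layer heat potential of $\sigma_d$ with the time integral truncated at $\Delta t-\epsilon^2$. Suppose that $\Delta t=2^N\epsilon^2$ with an integer $N\ge 0$, so that $[0,\Delta t-\epsilon^2]$ is the union of the dyadic subintervals $[\Delta t-2^{i+1}\epsilon^2,\ \Delta t-2^{i}\epsilon^2]$, $0\le i\le N-1$. Let $Q_n$ be the composite quadrature value obtained by applying to $\Phi$ the $n$-point Gauss--Legendre rule, $n\ge 1$, on each of these subintervals, and let $E_n=|S^{\epsilon}[\sigma_d](\mathbf{x},\Delta t)-Q_n|$. Then there is an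 absolute constant $C>0$, independent of $d$, $x$, $\epsilon$, $\Delta t$, $N$ and $n$, such that $$E_n\le C\,\log_2\!\left(\frac{\Delta t}{\epsilon^2}\right)\frac{n^{1/4}}{16^n}.$$ -/

import Mathlib

noncomputable section

namespace HeatQuad

/-- The fundamental solution `G(z, t) = exp(-‖z‖² / 4t) / (4πt)` of the heat equation in the
plane. -/
def heatKernel (z : EuclideanSpace ℝ (Fin 2)) (t : ℝ) : ℝ :=
  Real.exp (-‖z‖ ^ 2 / (4 * t)) / (4 * Real.pi * t)

/-- The point `(s, 0)` of the x-axis; `s` is the arc length parameter. -/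
def axisPoint (s : ℝ) : EuclideanSpace ℝ (Fin 2) := !₂[s, 0]

/-- The time integrand of the single layer potential over the (stationary) x-axis, with the
time-independent density `σ`, at target `z` and final time `T`:
`τ ↦ ∫_{-∞}^{∞} G(z - (y, 0), T - τ) σ(y) dy`. -/
def singleLayerIntegrand (σ : ℝ → ℝ) (z : EuclideanSpace ℝ (Fin 2)) (T τ : ℝ) : ℝ :=
  ∫ y : ℝ, heatKernel (z - axisPoint y) (T - τ) * σ y

/-- The single layer potential over the x-axis, with the time integral truncated at `T - ε²`. -/
def truncatedSingleLayer (σ : ℝ → ℝ) (ε : ℝ) (z : EuclideanSpace ℝ (Fin 2)) (T : ℝ) : ℝ :=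
  ∫ τ in (0 : ℝ)..(T - ε ^ 2), singleLayerIntegrand σ z T τ

/-- The Gaussian density `σ_d(y) = exp(-y² / 4d) / √(4πd)`. -/
def gaussianDensity (d y : ℝ) : ℝ :=
  Real.exp (-y ^ 2 / (4 * d)) / Real.sqrt (4 * Real.pi * d)

/-- The Gauss-Legendre nodes on `[0, 1]`: the zeros of the shifted Legendre polynomial
`P_n(2x - 1)` (up to sign) of degree `n`. -/
def gaussLegendreNodes (n : ℕ) : Finset ℝ :=
  ((Polynomial.shiftedLegendre n).map (Int.castRingHom ℝ)).roots.toFinset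

/-- The Gauss-Legendre weight on `[0, 1]` attached to the node `c`: the integral of the Lagrange
basis polynomial that is `1` at `c` and `0` at the other nodes. -/
def gaussLegendreWeight (n : ℕ) (c : ℝ) : ℝ :=
  ∫ u in (0 : ℝ)..1, (Lagrange.basis (gaussLegendreNodes n) id c).eval u

/-- The `n`-point Gauss-Legendre rule, scaled to the interval `[a, b]` and applied to `f`. -/
def gaussLegendre (n : ℕ) (a b : ℝ) (f : ℝ → ℝ) : ℝ :=
  (b - a) * ∑ c ∈ gaussLegendreNodes n, gaussLegendreWeight n c * f (a + (b - a) * c)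

/-- The `n`-point Gauss-Legendre rule applied on each of the `N` dyadic subintervals
`[T - 2^(i+1) ε², T - 2^i ε²]`, `0 ≤ i < N`. -/
def dyadicGaussLegendre (n N : ℕ) (ε T : ℝ) (f : ℝ → ℝ) : ℝ :=
  ∑ i ∈ Finset.range N, gaussLegendre n (T - 2 ^ (i + 1) * ε ^ 2) (T - 2 ^ i * ε ^ 2) f

end HeatQuad

end

/-! The time integrand is a superposition of exponentials `exp (-ρ (T - τ))` with `ρ ≥ 0` and signed
amplitudes `W`, `|W| ≤ 1`: combine a Gaussian integral with a Fourier integral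
(`singleLayerIntegrand_eq_laplace`). On a dyadic panel `[T - 2h, T - h]`, set `T - τ = h (2 - u)`
with `u ∈ [0, 1]`.

The Gauss error of `exp (ρ u)` is nonnegative, since all its Taylor coefficients are
(`gaussError_exp_nonneg`). Hence replacing `W` by `1` can only increase the error
(`abs_gaussError_integral_laplace_le`). This removes `d` and `x`, and the superposition collapses to
a multiple of `(2 - u)⁻¹`.

For that one function, exactness in degree below `2 n`, positive weights and a Chebyshev-type
approximant give the error bound `2 / 17 ^ n` (`gaussError_inv_le`). Each of the `N = logb 2 (Δt / ε
^ 2)` panels thus contributes at most `17⁻ⁿ`, which is below the claimed rate. -/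

section

open Polynomial MeasureTheory

namespace HeatQuad

/-! ### Zeros and orthogonality of the shifted Legendre polynomials -/

/-- The shifted Legendre polynomial with real coefficients. -/
noncomputable def legendreReal (n : ℕ) : ℝ[X] := (shiftedLegendre n).map (Int.castRingHom ℝ)

theorem natDegree_legendreReal (n : ℕ) : (legendreReal n).natDegree = n := by
  rw [legendreReal, natDegree_map_eq_of_injective (RingHom.injective_int _),
    natDegree_shiftedLegendre]

theorem legendreReal_ne_zero (n : ℕ) : legendreReal n ≠ 0 := by
  rw [legendreReal, Ne, Polynomial.map_eq_zero_iff (RingHom.injective_int _)]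
  intro h
  have := degree_shiftedLegendre n
  simp [h] at this

/-- The iterated derivatives of `x ^ n (1 - x) ^ n` appearing in the Rodrigues formula. -/
noncomputable def rodrigues (n k : ℕ) : ℝ[X] := derivative^[k] (X ^ n * (1 - X) ^ n)

theorem rodrigues_succ (n k : ℕ) : rodrigues n (k + 1) = derivative (rodrigues n k) :=
  Function.iterate_succ_apply' _ _ _

theorem rodrigues_self (n : ℕ) :
    rodrigues n n = C (n.factorial : ℝ) * legendreReal n := by
  have h := congrArg (Polynomial.map (Int.castRingHom ℝ)) (factorial_mul_shiftedLegendre_eq n)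
  rw [Polynomial.map_mul, ← iterate_derivative_map] at h
  simp only [Polynomial.map_mul, Polynomial.map_pow, Polynomial.map_sub, Polynomial.map_one,
    map_X, Polynomial.map_natCast] at h
  rw [rodrigues, ← h, legendreReal, C_eq_natCast]

theorem rodrigues_ne_zero {n k : ℕ} (hk : k ≤ n) : rodrigues n k ≠ 0 := by
  obtain ⟨m, rfl⟩ := Nat.exists_eq_add_of_le hk
  intro h
  apply mul_ne_zero (C_ne_zero.2 (Nat.cast_ne_zero.2 (Nat.factorial_ne_zero (k + m))))
    (legendreReal_ne_zero (k + m))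
  rw [← rodrigues_self, rodrigues, add_comm k m, Function.iterate_add_apply, add_comm m k]
  change derivative^[m] (rodrigues (k + m) k) = 0
  rw [h, iterate_derivative_zero]

theorem eval_rodrigues_zero {n k : ℕ} (hk : k < n) : (rodrigues n k).eval 0 = 0 := by
  have h : (X : ℝ[X]) ^ (n - k) ∣ rodrigues n k :=
    pow_sub_dvd_iterate_derivative_of_pow_dvd k (dvd_mul_right _ _)
  have := eval_dvd (x := (0 : ℝ)) h
  simpa [Nat.sub_ne_zero_of_lt hk] using this

theorem eval_rodrigues_one {n k : ℕ} (hk : k < n) : (rodrigues n k).eval 1 = 0 := by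
  have h : (1 - X : ℝ[X]) ^ (n - k) ∣ rodrigues n k :=
    pow_sub_dvd_iterate_derivative_of_pow_dvd k (dvd_mul_left _ _)
  have := eval_dvd (x := (1 : ℝ)) h
  simpa [Nat.sub_ne_zero_of_lt hk] using this

/-- Rolle by induction on `k`: each differentiation gives a new root between consecutive old ones,
while `0` and `1` stay roots as long as `k < n`. -/
theorem le_card_roots_rodrigues {n k : ℕ} (hk : k < n) :
    k + 2 ≤ (rodrigues n k).roots.toFinset.card := by
  have hmem : ∀ j < n, ({0, 1} : Finset ℝ) ⊆ (rodrigues n j).roots.toFinset := by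
    intro j hj x hx
    rw [Multiset.mem_toFinset, mem_roots (rodrigues_ne_zero hj.le), IsRoot.def]
    rcases Finset.mem_insert.1 hx with rfl | hx
    · exact eval_rodrigues_zero hj
    · rw [Finset.mem_singleton.1 hx]
      exact eval_rodrigues_one hj
  induction k with
  | zero => simpa using Finset.card_le_card (hmem 0 hk)
  | succ k ih =>
    have h1 := card_roots_toFinset_le_card_roots_derivative_sdiff_roots_succ (rodrigues n k)
    rw [← rodrigues_succ] at h1
    have h2 : ((rodrigues n (k + 1)).roots.toFinset \ (rodrigues n k).roots.toFinset).card
        + ({0, 1} : Finset ℝ).card ≤ (rodrigues n (k + 1)).roots.toFinset.card := by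
      rw [← Finset.card_union_of_disjoint]
      · exact Finset.card_le_card (Finset.union_subset Finset.sdiff_subset (hmem _ hk))
      · exact Finset.disjoint_of_subset_right (hmem k (by omega)) Finset.sdiff_disjoint
    have h3 : ({0, 1} : Finset ℝ).card = 2 := by simp
    have := ih (by omega)
    omega

theorem mem_gaussLegendreNodes {n : ℕ} {c : ℝ} :
    c ∈ gaussLegendreNodes n ↔ (legendreReal n).eval c = 0 := by
  rw [gaussLegendreNodes, Multiset.mem_toFinset, ← legendreReal,
    mem_roots (legendreReal_ne_zero n), IsRoot.def]

/-- A last use of Rolle shows that all Legendre roots are real and simple, so `toFinset` loses none.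
-/
theorem card_gaussLegendreNodes (n : ℕ) : (gaussLegendreNodes n).card = n := by
  apply le_antisymm
  · calc (gaussLegendreNodes n).card ≤ Multiset.card (legendreReal n).roots :=
          Multiset.toFinset_card_le _
      _ ≤ n := (card_roots' _).trans_eq (natDegree_legendreReal n)
  · rcases n with _ | n
    · simp
    · have h1 := le_card_roots_rodrigues (Nat.lt_add_one n)
      have h2 := card_roots_toFinset_le_derivative (rodrigues (n + 1) n)
      rw [← rodrigues_succ, rodrigues_self, roots_C_mul _ (by positivity)] at h2
      change _ ≤ (gaussLegendreNodes (n + 1)).card + 1 at h2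
      omega

/-- The coefficients alternate in sign and the constant term is `1`. With the symmetry `x ↦ 1 - x`,
this confines the nodes to `(0, 1)`. -/
theorem legendreReal_eval_pos {n : ℕ} {c : ℝ} (hc : c ≤ 0) : 0 < (legendreReal n).eval c := by
  rw [legendreReal, shiftedLegendre, Polynomial.map_sum, eval_finsetSum,
    Finset.sum_range_succ']
  apply add_pos_of_nonneg_of_pos
  · refine Finset.sum_nonneg fun k _ => ?_
    simp only [Polynomial.map_mul, Polynomial.map_pow, map_X, map_C, eval_mul, eval_C, eval_pow,
      eval_X, Int.coe_castRingHom]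
    push_cast
    have : 0 ≤ ((-1) * c) ^ (k + 1) := pow_nonneg (by linarith) _
    rw [mul_pow] at this
    calc (0 : ℝ) ≤ ((-1) ^ (k + 1) * c ^ (k + 1)) * (n.choose (k + 1) * (n + (k + 1)).choose n) := by
          positivity
      _ = _ := by ring
  · simp

theorem legendreReal_eval_symm (n : ℕ) (x : ℝ) :
    (legendreReal n).eval x = (-1) ^ n * (legendreReal n).eval (1 - x) := by
  simpa [legendreReal, eval_map, aeval_def] using shiftedLegendre_eval_symm n x

theorem gaussLegendreNodes_pos {n : ℕ} {c : ℝ} (hc : c ∈ gaussLegendreNodes n) : 0 < c := by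
  by_contra! h
  exact (legendreReal_eval_pos h).ne' (mem_gaussLegendreNodes.1 hc)

theorem gaussLegendreNodes_lt_one {n : ℕ} {c : ℝ} (hc : c ∈ gaussLegendreNodes n) : c < 1 := by
  have : 1 - c ∈ gaussLegendreNodes n := by
    rw [mem_gaussLegendreNodes] at hc ⊢
    have h := legendreReal_eval_symm n (1 - c)
    rwa [sub_sub_cancel, hc, mul_zero] at h
  linarith [gaussLegendreNodes_pos this]

/-- Integrate by parts `k` times; the boundary terms vanish because lower derivatives are zero at
`0` and `1`. -/
theorem integral_rodrigues_mul {n k : ℕ} (hk : k ≤ n) (q : ℝ[X]) (hq : derivative^[k] q = 0) :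
    ∫ u in (0 : ℝ)..1, (rodrigues n k).eval u * q.eval u = 0 := by
  induction k generalizing q with
  | zero => simp only [Function.iterate_zero, id] at hq; simp [hq]
  | succ k ih =>
    have h := intervalIntegral.integral_mul_deriv_eq_deriv_mul (a := 0) (b := 1)
      (fun x _ => q.hasDerivAt x) (fun x _ => (rodrigues n k).hasDerivAt x)
      (q.derivative.continuous.intervalIntegrable _ _)
      ((rodrigues n k).derivative.continuous.intervalIntegrable _ _)
    rw [eval_rodrigues_zero (by omega), eval_rodrigues_one (by omega)] at h
    simp only [mul_comm (q.derivative.eval _)] at h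
    rw [ih (by omega) q.derivative hq] at h
    simpa [rodrigues_succ, mul_comm] using h

theorem integral_legendreReal_mul {n : ℕ} (q : ℝ[X]) (hq : q.degree < n) :
    ∫ u in (0 : ℝ)..1, (legendreReal n).eval u * q.eval u = 0 := by
  rcases n with _ | n
  · have : q = 0 := by simpa using hq
    simp [this]
  rcases eq_or_ne q 0 with rfl | hq0
  · simp
  have h := integral_rodrigues_mul le_rfl q
    (iterate_derivative_eq_zero ((natDegree_lt_iff_degree_lt hq0).2 hq))
  rw [rodrigues_self] at h
  simp only [eval_mul, eval_C, mul_assoc, intervalIntegral.integral_const_mul] at h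
  exact (mul_eq_zero.1 h).resolve_left (by positivity)

/-! ### The error functional: exactness and positive weights -/

/-- The error of the Gauss-Legendre rule on `[0, 1]`. -/
noncomputable def gaussError (n : ℕ) (f : ℝ → ℝ) : ℝ :=
  (∫ u in (0 : ℝ)..1, f u) - ∑ c ∈ gaussLegendreNodes n, gaussLegendreWeight n c * f c

theorem gaussError_add {n : ℕ} {f g : ℝ → ℝ} (hf : IntervalIntegrable f volume 0 1)
    (hg : IntervalIntegrable g volume 0 1) :
    gaussError n (fun u => f u + g u) = gaussError n f + gaussError n g := by
  simp only [gaussError, mul_add, Finset.sum_add_distrib, intervalIntegral.integral_add hf hg]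
  ring

theorem gaussError_const_mul (n : ℕ) (a : ℝ) (f : ℝ → ℝ) :
    gaussError n (fun u => a * f u) = a * gaussError n f := by
  simp only [gaussError, mul_left_comm _ a, ← Finset.mul_sum, intervalIntegral.integral_const_mul]
  ring

theorem gaussError_interpolated {n : ℕ} (r : ℝ[X]) (hr : r.degree < n) :
    gaussError n (fun u => r.eval u) = 0 := by
  have hr' : r.degree < (gaussLegendreNodes n).card := by rwa [card_gaussLegendreNodes]
  have h := Lagrange.eq_interpolate (v := id) (Function.injective_id.injOn) hr'
  rw [gaussError, sub_eq_zero]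
  conv_lhs => rw [h]
  simp only [Lagrange.interpolate_apply, eval_finsetSum, eval_mul, eval_C]
  rw [intervalIntegral.integral_finsetSum]
  · refine Finset.sum_congr rfl fun c _ => ?_
    rw [intervalIntegral.integral_const_mul, gaussLegendreWeight, mul_comm]
    rfl
  · exact fun c _ => ((Lagrange.basis _ id c).continuous.const_mul _ |>.intervalIntegrable _ _)

theorem gaussError_legendreReal_mul {n : ℕ} (q : ℝ[X]) (hq : q.degree < n) :
    gaussError n (fun u => (legendreReal n).eval u * q.eval u) = 0 := by
  rw [gaussError, integral_legendreReal_mul q hq, zero_sub, neg_eq_zero]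
  refine Finset.sum_eq_zero fun c hc => ?_
  rw [mem_gaussLegendreNodes.1 hc, zero_mul, mul_zero]

/-- The Gauss-Legendre rule is exact on polynomials of degree less than `2 n`. -/
theorem gaussError_polynomial {n : ℕ} (p : ℝ[X]) (hp : p.degree < (2 * n : ℕ)) :
    gaussError n (fun u => p.eval u) = 0 := by
  have h0 := legendreReal_ne_zero n
  have hd : (legendreReal n).degree = n := by
    rw [degree_eq_natDegree h0, natDegree_legendreReal]
  have hq : (p / legendreReal n).degree < n := by
    by_cases hz : p / legendreReal n = 0
    · rw [hz, degree_zero]; exact WithBot.bot_lt_coe n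
    have hle : (legendreReal n).degree ≤ p.degree := by
      by_contra! hlt
      exact hz ((Polynomial.div_eq_zero_iff h0).2 hlt)
    have h := degree_add_div h0 hle
    have hp0 : p ≠ 0 := by rintro rfl; simp at hz
    rw [degree_eq_natDegree hz, degree_eq_natDegree hp0, hd] at h
    rw [degree_eq_natDegree hp0] at hp
    rw [degree_eq_natDegree hz]
    norm_cast at h hp ⊢
    omega
  have hr : (p % legendreReal n).degree < n := hd ▸ EuclideanDomain.mod_lt p h0
  -- The quotient part is killed by orthogonality and by the nodes being zeros; the remainder is
  -- integrated exactly by interpolation.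
  have hsplit : ∀ u, p.eval u
      = (legendreReal n).eval u * (p / legendreReal n).eval u + (p % legendreReal n).eval u := by
    intro u
    conv_lhs => rw [← EuclideanDomain.div_add_mod p (legendreReal n)]
    simp
  simp only [hsplit]
  rw [gaussError_add (Continuous.intervalIntegrable (by fun_prop) _ _)
    (Continuous.intervalIntegrable (by fun_prop) _ _), gaussError_legendreReal_mul _ hq,
    gaussError_interpolated _ hr, add_zero]

/-- The square of the Lagrange basis polynomial has degree `2 n - 2`, so the rule is exact on it,
and the rule returns precisely the weight. -/
theorem gaussLegendreWeight_nonneg {n : ℕ} {c : ℝ} (hc : c ∈ gaussLegendreNodes n) :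
    0 ≤ gaussLegendreWeight n c := by
  have hn : 1 ≤ n := by
    rw [← card_gaussLegendreNodes n]; exact Finset.card_pos.2 ⟨c, hc⟩
  set ℓ := Lagrange.basis (gaussLegendreNodes n) id c with hℓ
  have hdeg : ℓ.degree = ((n - 1 : ℕ) : WithBot ℕ) := by
    rw [hℓ, Lagrange.degree_basis Function.injective_id.injOn hc, card_gaussLegendreNodes]
  have h := gaussError_polynomial (n := n) (ℓ ^ 2) (by
    rw [degree_pow, hdeg, nsmul_eq_mul]; norm_cast; omega)
  rw [gaussError, sub_eq_zero, Finset.sum_eq_single c] at h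
  · have h1 : ℓ.eval c = 1 :=
      Lagrange.eval_basis_self (v := id) Function.injective_id.injOn hc
    rw [eval_pow, h1, one_pow, mul_one] at h
    rw [← h]
    refine intervalIntegral.integral_nonneg zero_le_one fun u _ => ?_
    rw [eval_pow]; positivity
  · intro b hb hbc
    have h1 : ℓ.eval b = 0 := Lagrange.eval_basis_of_ne (v := id) hbc.symm hb
    rw [eval_pow, h1]; simp
  · exact fun h => absurd hc h

theorem sum_gaussLegendreWeight {n : ℕ} (hn : 1 ≤ n) :
    ∑ c ∈ gaussLegendreNodes n, gaussLegendreWeight n c = 1 := by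
  have h := gaussError_polynomial (n := n) (1 : ℝ[X]) (by rw [degree_one]; norm_cast; omega)
  simp only [gaussError, eval_one, mul_one, intervalIntegral.integral_const, sub_zero,
    smul_eq_mul] at h
  linarith

/-! ### Sign of the error for nonnegative Taylor coefficients -/

theorem coeff_divByMonic_X_sub_C_nonneg {p : ℝ[X]} (hp : ∀ k, 0 ≤ p.coeff k) {c : ℝ} (hc : 0 ≤ c)
    (k : ℕ) : 0 ≤ (p /ₘ (X - C c)).coeff k := by
  rw [coeff_divByMonic_X_sub_C]
  exact Finset.sum_nonneg fun i _ => mul_nonneg (pow_nonneg hc _) (hp i)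

/-- Dividing a polynomial with nonnegative coefficients by a product of linear factors with
nonnegative roots gives a quotient with nonnegative coefficients. -/
theorem exists_quotient_coeff_nonneg (s : Multiset ℝ) (hs : ∀ c ∈ s, 0 ≤ c) (p : ℝ[X])
    (hp : ∀ k, 0 ≤ p.coeff k) :
    ∃ q r : ℝ[X], p = (s.map fun c => X - C c).prod * q + r ∧ (∀ k, 0 ≤ q.coeff k) ∧
      r.degree < s.card := by
  induction s using Multiset.induction_on generalizing p with
  | empty => exact ⟨p, 0, by simp, hp, by simp⟩
  | cons c s ih =>
    obtain ⟨q, r, h, hq, hr⟩ := ih (fun b hb => hs b (Multiset.mem_cons_of_mem hb))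
      (p /ₘ (X - C c))
      (coeff_divByMonic_X_sub_C_nonneg hp (hs c (Multiset.mem_cons_self c s)))
    refine ⟨q, (X - C c) * r + C (p.eval c), ?_, hq, ?_⟩
    · have h1 := modByMonic_add_div p (X - C c)
      rw [modByMonic_X_sub_C_eq_C_eval, h] at h1
      rw [Multiset.map_cons, Multiset.prod_cons]
      conv_lhs => rw [← h1]
      ring
    · refine (degree_add_le _ _).trans_lt (max_lt ?_ ?_)
      · by_cases hr0 : r = 0
        · rw [hr0, mul_zero, degree_zero]
          exact WithBot.bot_lt_coe _
        rw [degree_mul, degree_X_sub_C]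
        rw [degree_eq_natDegree hr0] at hr ⊢
        rw [Multiset.card_cons]
        norm_cast at hr ⊢
        omega
      · refine degree_C_le.trans_lt ?_
        rw [Multiset.card_cons]
        norm_cast
        omega

theorem eval_nonneg_of_coeff_nonneg {p : ℝ[X]} (hp : ∀ k, 0 ≤ p.coeff k) {u : ℝ} (hu : 0 ≤ u) :
    0 ≤ p.eval u := by
  rw [eval_eq_sum_range]
  exact Finset.sum_nonneg fun k _ => mul_nonneg (hp k) (pow_nonneg hu k)

/-- The Gauss-Legendre rule underestimates the integral of a polynomial with nonnegative
coefficients. -/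
theorem gaussError_nonneg_of_coeff_nonneg (n : ℕ) {p : ℝ[X]} (hp : ∀ k, 0 ≤ p.coeff k) :
    0 ≤ gaussError n (fun u => p.eval u) := by
  -- Each node is taken twice, so the divisor is a square `Q * Q` and `r` has degree below `2 n`.
  -- The error is then the integral of `Q * Q * q ≥ 0`, which vanishes at the nodes.
  obtain ⟨q, r, h, hq, hr⟩ := exists_quotient_coeff_nonneg
    ((gaussLegendreNodes n).val + (gaussLegendreNodes n).val)
    (fun c hc => by
      rw [Multiset.mem_add, or_self] at hc
      exact (gaussLegendreNodes_pos hc).le) p hp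
  have hcard := card_gaussLegendreNodes n
  rw [Multiset.card_add, Finset.card_val, hcard, ← two_mul] at hr
  rw [Multiset.map_add, Multiset.prod_add] at h
  change p = (∏ c ∈ gaussLegendreNodes n, (X - C c)) * (∏ c ∈ gaussLegendreNodes n, (X - C c)) * q
    + r at h
  set Q := ∏ c ∈ gaussLegendreNodes n, (X - C c) with hQ
  have hp' : ∀ u, p.eval u = (Q * Q * q).eval u + r.eval u := fun u => by rw [h, eval_add]
  simp only [hp']
  rw [gaussError_add ((Q * Q * q).continuous.intervalIntegrable _ _)
    (r.continuous.intervalIntegrable _ _), gaussError_polynomial r hr, add_zero, gaussError,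
    Finset.sum_eq_zero, sub_zero]
  · refine intervalIntegral.integral_nonneg zero_le_one fun u hu => ?_
    rw [eval_mul, eval_mul]
    exact mul_nonneg (mul_self_nonneg _) (eval_nonneg_of_coeff_nonneg hq hu.1)
  · intro c hc
    have : Q.eval c = 0 := by
      rw [hQ, eval_prod]
      exact Finset.prod_eq_zero hc (by simp)
    simp [this]

theorem hasSum_gaussError_exp (n : ℕ) (t : ℝ) :
    HasSum (fun k : ℕ => gaussError n fun u => t ^ k / k.factorial * u ^ k)
      (gaussError n fun u => Real.exp (t * u)) := by
  have hexp : ∀ u : ℝ, HasSum (fun k : ℕ => t ^ k / k.factorial * u ^ k) (Real.exp (t * u)) := by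
    intro u
    have h := NormedSpace.expSeries_div_hasSum_exp (t * u)
    rw [← Real.exp_eq_exp_ℝ] at h
    refine h.congr_fun ?_
    intro k
    rw [mul_pow]; ring
  refine HasSum.sub ?_ ?_
  · refine intervalIntegral.hasSum_integral_of_dominated_convergence
      (fun k _ => |t| ^ k / k.factorial) (fun k => ?_) (fun k => ?_) ?_ ?_ ?_
    · exact Continuous.aestronglyMeasurable (by fun_prop)
    · refine Filter.Eventually.of_forall fun u hu => ?_
      rw [Set.uIoc_of_le zero_le_one] at hu
      rw [norm_mul, norm_div, norm_pow, norm_pow, Real.norm_eq_abs, Real.norm_eq_abs,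
        Real.norm_eq_abs, abs_of_pos hu.1, Nat.abs_cast]
      exact mul_le_of_le_one_right (by positivity) (pow_le_one₀ hu.1.le hu.2)
    · exact Filter.Eventually.of_forall fun u _ => Real.summable_pow_div_factorial _
    · exact intervalIntegrable_const
    · exact Filter.Eventually.of_forall fun u _ => hexp u
  · exact hasSum_sum fun c _ => (hexp c).mul_left _

theorem gaussError_exp_nonneg (n : ℕ) {t : ℝ} (ht : 0 ≤ t) :
    0 ≤ gaussError n fun u => Real.exp (t * u) := by
  refine (hasSum_gaussError_exp n t).nonneg fun k => ?_
  have h := gaussError_nonneg_of_coeff_nonneg n (p := C (t ^ k / k.factorial) * X ^ k) (by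
    intro j
    rw [coeff_C_mul_X_pow]
    split_ifs <;> positivity)
  simpa using h

/-! ### The error for the model function `(2 - u)⁻¹` -/

theorem gaussError_congr {n : ℕ} {f g : ℝ → ℝ} (h : ∀ u ∈ Set.Icc (0 : ℝ) 1, f u = g u) :
    gaussError n f = gaussError n g := by
  rw [gaussError, gaussError]
  congr 1
  · refine intervalIntegral.integral_congr fun u hu => ?_
    rw [Set.uIcc_of_le zero_le_one] at hu
    exact h u hu
  · refine Finset.sum_congr rfl fun c hc => ?_
    rw [h c ⟨(gaussLegendreNodes_pos hc).le, (gaussLegendreNodes_lt_one hc).le⟩]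

theorem gaussError_le {n : ℕ} (hn : 1 ≤ n) {f : ℝ → ℝ} {M : ℝ}
    (hM : ∀ u ∈ Set.Icc (0 : ℝ) 1, |f u| ≤ M) : gaussError n f ≤ 2 * M := by
  have h1 : ∫ u in (0 : ℝ)..1, f u ≤ M := by
    have h := intervalIntegral.norm_integral_le_of_norm_le_const (a := 0) (b := 1) (f := f) (C := M)
      (fun u hu => by
        rw [Set.uIoc_of_le zero_le_one] at hu
        exact hM u ⟨hu.1.le, hu.2⟩)
    rw [sub_zero, abs_one, mul_one] at h
    exact (le_abs_self _).trans h
  have h2 : -M ≤ ∑ c ∈ gaussLegendreNodes n, gaussLegendreWeight n c * f c := by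
    rw [← mul_one (-M), ← sum_gaussLegendreWeight hn, Finset.mul_sum]
    refine Finset.sum_le_sum fun c hc => ?_
    rw [mul_comm]
    exact mul_le_mul_of_nonneg_left
      (abs_le.1 (hM c ⟨(gaussLegendreNodes_pos hc).le, (gaussLegendreNodes_lt_one hc).le⟩)).1
      (gaussLegendreWeight_nonneg hc)
  rw [gaussError]
  linarith

/-- If `B` has degree at most `2` and `B 2 = 1`, then `(1 - B ^ n) / (2 - u)` is a polynomial of
degree below `2 n`. Only `B ^ n / (2 - u)` contributes to the error. -/
theorem gaussError_inv_le {n : ℕ} (hn : 1 ≤ n) :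
    gaussError n (fun u => (2 - u)⁻¹) ≤ 2 * (1 / 17) ^ n := by
  -- The Chebyshev polynomial `T₂ (2 u - 1)`, bounded by `1` on `[0, 1]`, divided by its value `T₂ 3
  -- = 17` at `u = 2`.
  set B : ℝ[X] := C (1 / 17) * (C 2 * (C 2 * X - C 1) ^ 2 - C 1) with hB
  have hBeval : ∀ u, B.eval u = 1 / 17 * (2 * (2 * u - 1) ^ 2 - 1) := by intro u; simp [hB]
  have hBdeg : B.natDegree ≤ 2 := by rw [hB]; compute_degree
  obtain ⟨g, hg⟩ : (X - C (2 : ℝ)) ∣ 1 - B ^ n := by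
    rw [dvd_iff_isRoot, IsRoot.def, eval_sub, eval_pow, hBeval]
    norm_num
  have hgdeg : g.degree < (2 * n : ℕ) := by
    by_cases hg0 : g = 0
    · rw [hg0, degree_zero]
      exact WithBot.bot_lt_coe _
    have h1 : (1 - B ^ n).natDegree ≤ 2 * n := by
      refine (natDegree_sub_le _ _).trans (max_le (by simp) ?_)
      refine natDegree_pow_le.trans ?_
      rw [mul_comm]
      exact Nat.mul_le_mul_right n hBdeg
    rw [hg, natDegree_mul (X_sub_C_ne_zero 2) hg0, natDegree_X_sub_C] at h1
    rw [degree_eq_natDegree hg0]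
    norm_cast
    omega
  have hne : ∀ u ∈ Set.Icc (0 : ℝ) 1, 2 - u ≠ 0 := fun u hu => by linarith [hu.2]
  have hsplit : ∀ u ∈ Set.Icc (0 : ℝ) 1,
      (2 - u)⁻¹ = (-g).eval u + (B ^ n).eval u * (2 - u)⁻¹ := by
    intro u hu
    have h := congrArg (eval u) hg
    simp only [eval_sub, eval_one, eval_mul, eval_X, eval_C] at h
    have := hne u hu
    rw [eval_neg]
    field_simp
    linarith
  rw [gaussError_congr hsplit, gaussError_add ((-g).continuous.intervalIntegrable _ _),
    gaussError_polynomial (-g) (by rwa [degree_neg]), zero_add]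
  · refine gaussError_le hn fun u hu => ?_
    rw [eval_pow, abs_mul, abs_pow]
    have h1 : |B.eval u| ≤ 1 / 17 := by
      rw [hBeval, abs_le]
      have := hu.1
      have := hu.2
      constructor <;> nlinarith
    have h2 : |(2 - u)⁻¹| ≤ 1 := by
      rw [abs_of_pos (inv_pos.2 (by linarith [hu.2]))]
      exact inv_le_one_of_one_le₀ (by linarith [hu.2])
    calc |B.eval u| ^ n * |(2 - u)⁻¹| ≤ (1 / 17) ^ n * 1 := by gcongr
      _ = (1 / 17) ^ n := mul_one _
  · apply ContinuousOn.intervalIntegrable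
    rw [Set.uIcc_of_le zero_le_one]
    exact (B ^ n).continuous.continuousOn.mul
      (ContinuousOn.inv₀ (by fun_prop) hne)

/-! ### Domination for signed superpositions of exponentials -/

section Superposition

variable {α : Type*} [MeasurableSpace α] {μ : Measure α} {W ρ : α → ℝ}

theorem integrable_laplace (hW : Measurable W) (hW1 : ∀ a, |W a| ≤ 1) (hρ : Measurable ρ)
    (hρ0 : ∀ a, 0 ≤ ρ a) (hint : Integrable (fun a => Real.exp (-ρ a)) μ) {u : ℝ} (hu : u ≤ 1) :
    Integrable (fun a => W a * Real.exp (-(ρ a * (2 - u)))) μ := by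
  refine hint.mono' (Measurable.aestronglyMeasurable (by fun_prop))
    (Filter.Eventually.of_forall fun a => ?_)
  rw [norm_mul, Real.norm_eq_abs, Real.norm_eq_abs, Real.abs_exp]
  calc |W a| * Real.exp (-(ρ a * (2 - u))) ≤ 1 * Real.exp (-ρ a) := by
        gcongr
        · exact hW1 _
        · nlinarith [hρ0 a]
    _ = Real.exp (-ρ a) := one_mul _

variable [SFinite μ]

theorem integrable_laplace_prod (hW : Measurable W) (hW1 : ∀ a, |W a| ≤ 1) (hρ : Measurable ρ)
    (hρ0 : ∀ a, 0 ≤ ρ a) (hint : Integrable (fun a => Real.exp (-ρ a)) μ) :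
    Integrable (Function.uncurry fun (u : ℝ) (a : α) => W a * Real.exp (-(ρ a * (2 - u))))
      ((volume.restrict (Set.Ioc (0 : ℝ) 1)).prod μ) := by
  refine (hint.comp_snd (volume.restrict (Set.Ioc (0 : ℝ) 1))).mono'
    (Measurable.aestronglyMeasurable ?_) ?_
  · unfold Function.uncurry
    fun_prop
  · have h : ∀ᵐ u ∂(volume.restrict (Set.Ioc (0 : ℝ) 1)), u ∈ Set.Ioc (0 : ℝ) 1 :=
      ae_restrict_mem measurableSet_Ioc
    filter_upwards [Measure.quasiMeasurePreserving_fst.ae h] with z hz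
    rw [Function.uncurry, norm_mul, Real.norm_eq_abs, Real.norm_eq_abs, Real.abs_exp]
    calc |W z.2| * Real.exp (-(ρ z.2 * (2 - z.1))) ≤ 1 * Real.exp (-ρ z.2) := by
          gcongr
          · exact hW1 _
          · nlinarith [hρ0 z.2, hz.2]
      _ = Real.exp (-ρ z.2) := one_mul _

theorem integrable_gaussError_laplace (n : ℕ) (hW : Measurable W) (hW1 : ∀ a, |W a| ≤ 1)
    (hρ : Measurable ρ) (hρ0 : ∀ a, 0 ≤ ρ a) (hint : Integrable (fun a => Real.exp (-ρ a)) μ) :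
    Integrable (fun a => gaussError n fun u => W a * Real.exp (-(ρ a * (2 - u)))) μ := by
  simp only [gaussError, intervalIntegral.integral_of_le zero_le_one]
  exact (integrable_laplace_prod hW hW1 hρ hρ0 hint).integral_prod_right.sub
    (integrable_finsetSum _ fun c hc =>
      (integrable_laplace hW hW1 hρ hρ0 hint (gaussLegendreNodes_lt_one hc).le).const_mul _)

theorem gaussError_integral_laplace (n : ℕ) (hW : Measurable W) (hW1 : ∀ a, |W a| ≤ 1)
    (hρ : Measurable ρ) (hρ0 : ∀ a, 0 ≤ ρ a) (hint : Integrable (fun a => Real.exp (-ρ a)) μ) :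
    gaussError n (fun u => ∫ a, W a * Real.exp (-(ρ a * (2 - u))) ∂μ)
      = ∫ a, gaussError n (fun u => W a * Real.exp (-(ρ a * (2 - u)))) ∂μ := by
  have hnode : ∀ c ∈ gaussLegendreNodes n, Integrable
      (fun a => gaussLegendreWeight n c * (W a * Real.exp (-(ρ a * (2 - c))))) μ := fun c hc =>
    (integrable_laplace hW hW1 hρ hρ0 hint (gaussLegendreNodes_lt_one hc).le).const_mul _
  have hprod := integrable_laplace_prod hW hW1 hρ hρ0 hint
  have hleft := hprod.integral_prod_right
  simp only [Function.uncurry_apply_pair] at hleft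
  simp only [gaussError, intervalIntegral.integral_of_le zero_le_one]
  rw [integral_sub hleft (integrable_finsetSum _ hnode),
    integral_finsetSum _ hnode, integral_integral_swap hprod]
  simp only [integral_const_mul]

/-- The Gauss-Legendre error of a signed superposition of exponentials is dominated by the error
of the corresponding positive superposition. -/
theorem abs_gaussError_integral_laplace_le (n : ℕ) (hW : Measurable W) (hW1 : ∀ a, |W a| ≤ 1)
    (hρ : Measurable ρ) (hρ0 : ∀ a, 0 ≤ ρ a) (hint : Integrable (fun a => Real.exp (-ρ a)) μ) :
    |gaussError n fun u => ∫ a, W a * Real.exp (-(ρ a * (2 - u))) ∂μ|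
      ≤ gaussError n fun u => ∫ a, Real.exp (-(ρ a * (2 - u))) ∂μ := by
  have hone := gaussError_integral_laplace n (W := fun _ => 1) measurable_const (by simp) hρ hρ0 hint
  have hint1 := integrable_gaussError_laplace n (W := fun _ => 1) measurable_const (by simp)
    hρ hρ0 hint
  simp only [one_mul] at hone hint1
  rw [gaussError_integral_laplace n hW hW1 hρ hρ0 hint, hone, ← Real.norm_eq_abs]
  refine norm_integral_le_of_norm_le hint1 (Filter.Eventually.of_forall fun a => ?_)
  have hpos : 0 ≤ gaussError n (fun u => Real.exp (-(ρ a * (2 - u)))) := by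
    have h : ∀ u, Real.exp (-(ρ a * (2 - u))) = Real.exp (-(ρ a * 2)) * Real.exp (ρ a * u) := by
      intro u
      rw [← Real.exp_add]
      ring_nf
    simp only [h]
    rw [gaussError_const_mul]
    exact mul_nonneg (Real.exp_pos _).le (gaussError_exp_nonneg n (hρ0 a))
  rw [gaussError_const_mul, norm_mul, Real.norm_eq_abs, Real.norm_eq_abs, abs_of_nonneg hpos]
  exact mul_le_of_le_one_left hpos (hW1 a)

end Superposition

/-! ### Laplace representation of the time integrand -/

theorem integral_cos_mul_exp_neg_mul_sq {b : ℝ} (hb : 0 < b) (x : ℝ) :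
    ∫ k : ℝ, Real.cos (x * k) * Real.exp (-b * k ^ 2)
      = Real.sqrt (Real.pi / b) * Real.exp (-x ^ 2 / (4 * b)) := by
  have h := fourierIntegral_gaussian (b := (b : ℂ)) (by simpa using hb) (x : ℂ)
  have hR : ((Real.pi : ℂ) / b) ^ (1 / 2 : ℂ) * Complex.exp (-(x : ℂ) ^ 2 / (4 * b))
      = ((Real.sqrt (Real.pi / b) * Real.exp (-x ^ 2 / (4 * b)) : ℝ) : ℂ) := by
    rw [Real.sqrt_eq_rpow]
    push_cast [Complex.ofReal_cpow (show 0 ≤ Real.pi / b by positivity)]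
    rfl
  have hint : Integrable fun k : ℝ =>
      Complex.exp (Complex.I * x * k) * Complex.exp (-b * (k : ℂ) ^ 2) := by
    have := integrable_cexp_quadratic (b := (b : ℂ)) (by simpa using hb) (Complex.I * x) 0
    refine this.congr (Filter.Eventually.of_forall fun k => ?_)
    simp only [← Complex.exp_add]
    ring_nf
  rw [hR] at h
  have h2 := congrArg Complex.re h
  rw [Complex.ofReal_re] at h2
  rw [← h2, ← RCLike.re_eq_complex_re, ← integral_re hint]
  refine integral_congr_ae (Filter.Eventually.of_forall fun k => ?_)
  have e1 : Complex.exp (-b * (k : ℂ) ^ 2) = (Real.exp (-b * k ^ 2) : ℝ) := by push_cast; rfl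
  have e2 : Complex.exp (Complex.I * x * k) = Complex.exp ((x * k : ℝ) * Complex.I) := by
    push_cast; ring_nf
  simp only [RCLike.re_eq_complex_re]
  rw [e1, e2, Complex.re_mul_ofReal, Complex.exp_ofReal_mul_I_re]

theorem norm_axisPoint_sub_sq (x y : ℝ) : ‖axisPoint x - axisPoint y‖ ^ 2 = (x - y) ^ 2 := by
  rw [EuclideanSpace.real_norm_sq_eq]
  simp [axisPoint]

theorem integral_exp_mul_exp {s d : ℝ} (hs : 0 < s) (hd : 0 < d) (x : ℝ) :
    ∫ y : ℝ, Real.exp (-(x - y) ^ 2 / (4 * s)) * Real.exp (-y ^ 2 / (4 * d))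
      = Real.sqrt (Real.pi / ((s + d) / (4 * s * d))) * Real.exp (-x ^ 2 / (4 * (s + d))) := by
  have h : ∀ y : ℝ, Real.exp (-(x - y) ^ 2 / (4 * s)) * Real.exp (-y ^ 2 / (4 * d))
      = Real.exp (-((s + d) / (4 * s * d)) * (y - d * x / (s + d)) ^ 2)
        * Real.exp (-x ^ 2 / (4 * (s + d))) := by
    intro y
    rw [← Real.exp_add, ← Real.exp_add]
    congr 1
    field_simp
    ring
  simp only [h]
  rw [integral_mul_const,
    integral_sub_right_eq_self (fun y => Real.exp (-((s + d) / (4 * s * d)) * y ^ 2)),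
    integral_gaussian]

theorem singleLayerIntegrand_gaussianDensity {d T τ : ℝ} (hd : 0 < d) (hτ : τ < T) (x : ℝ) :
    singleLayerIntegrand (gaussianDensity d) (axisPoint x) T τ
      = 1 / (4 * Real.pi ^ 2) * (Real.sqrt (Real.pi / (T - τ))
        * (Real.sqrt (Real.pi / (T - τ + d)) * Real.exp (-x ^ 2 / (4 * (T - τ + d))))) := by
  obtain ⟨s, hs⟩ : ∃ s, s = T - τ := ⟨_, rfl⟩
  have hs0 : 0 < s := by linarith
  rw [singleLayerIntegrand, ← hs]
  have h : ∀ y, heatKernel (axisPoint x - axisPoint y) s * gaussianDensity d y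
      = (1 / (4 * Real.pi * s * Real.sqrt (4 * Real.pi * d)))
        * (Real.exp (-(x - y) ^ 2 / (4 * s)) * Real.exp (-y ^ 2 / (4 * d))) := by
    intro y
    rw [heatKernel, gaussianDensity, norm_axisPoint_sub_sq]
    field_simp
  simp only [h]
  rw [integral_const_mul, integral_exp_mul_exp hs0 hd]
  have hsqrt : Real.sqrt (Real.pi / ((s + d) / (4 * s * d)))
      = Real.sqrt (4 * Real.pi * d) * s * Real.sqrt (Real.pi / s) * Real.sqrt (Real.pi / (s + d))
        / Real.pi := by
    have hπ := Real.pi_pos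
    have hsq : Real.pi / ((s + d) / (4 * s * d)) = (Real.sqrt (4 * Real.pi * d) * s
        * Real.sqrt (Real.pi / s) * Real.sqrt (Real.pi / (s + d)) / Real.pi) ^ 2 := by
      simp only [div_pow, mul_pow]
      rw [Real.sq_sqrt (by positivity), Real.sq_sqrt (by positivity), Real.sq_sqrt (by positivity)]
      field_simp
    rw [hsq, Real.sqrt_sq (by positivity)]
  rw [hsqrt]
  have : Real.sqrt (4 * Real.pi * d) ≠ 0 := by positivity
  have := Real.pi_ne_zero
  field_simp

/-- The time integrand as a superposition of decaying exponentials in the elapsed time. -/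
theorem singleLayerIntegrand_eq_laplace {d T τ : ℝ} (hd : 0 < d) (hτ : τ < T) (x : ℝ) :
    singleLayerIntegrand (gaussianDensity d) (axisPoint x) T τ
      = 1 / (4 * Real.pi ^ 2) * ∫ z : ℝ × ℝ, (Real.cos (x * z.2) * Real.exp (-d * z.2 ^ 2))
          * Real.exp (-((z.1 ^ 2 + z.2 ^ 2) * (T - τ))) := by
  have hs : 0 < T - τ := sub_pos.2 hτ
  -- The factor `√(π / (T - τ))` becomes the integral over `z.1`; the remaining Gaussian in `x`
  -- becomes the cosine integral over `z.2`.
  rw [singleLayerIntegrand_gaussianDensity hd hτ, ← integral_gaussian,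
    ← integral_cos_mul_exp_neg_mul_sq (by positivity), ← integral_prod_mul]
  congr 1
  refine integral_congr_ae (Filter.Eventually.of_forall fun z => ?_)
  simp only
  rw [mul_left_comm, mul_assoc, ← Real.exp_add, ← Real.exp_add]
  ring_nf

theorem integral_prod_exp_neg {b : ℝ} (hb : 0 < b) :
    ∫ z : ℝ × ℝ, Real.exp (-((z.1 ^ 2 + z.2 ^ 2) * b)) = Real.pi / b := by
  have h : ∀ z : ℝ × ℝ, Real.exp (-((z.1 ^ 2 + z.2 ^ 2) * b))
      = Real.exp (-b * z.1 ^ 2) * Real.exp (-b * z.2 ^ 2) := fun z => by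
    rw [← Real.exp_add]; ring_nf
  simp only [h]
  rw [Measure.volume_eq_prod, integral_prod_mul (fun y : ℝ => Real.exp (-b * y ^ 2))
    (fun y : ℝ => Real.exp (-b * y ^ 2)), integral_gaussian, Real.mul_self_sqrt (by positivity)]

theorem integrable_prod_exp_neg {b : ℝ} (hb : 0 < b) :
    Integrable fun z : ℝ × ℝ => Real.exp (-((z.1 ^ 2 + z.2 ^ 2) * b)) := by
  have h := (integrable_exp_neg_mul_sq hb).mul_prod (integrable_exp_neg_mul_sq hb)
  rw [← Measure.volume_eq_prod] at h
  refine h.congr (Filter.Eventually.of_forall fun z => ?_)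
  simp only [← Real.exp_add]
  ring_nf

theorem continuousOn_singleLayerIntegrand {d : ℝ} (hd : 0 < d) (x T : ℝ) :
    ContinuousOn (singleLayerIntegrand (gaussianDensity d) (axisPoint x) T) (Set.Iio T) := by
  have h : ContinuousOn (fun τ => 1 / (4 * Real.pi ^ 2) * (Real.sqrt (Real.pi / (T - τ))
      * (Real.sqrt (Real.pi / (T - τ + d)) * Real.exp (-x ^ 2 / (4 * (T - τ + d)))))) (Set.Iio T) := by
    have h1 : ∀ τ ∈ Set.Iio T, T - τ ≠ 0 := fun τ hτ => (sub_pos.2 hτ).ne'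
    have h2 : ∀ τ ∈ Set.Iio T, T - τ + d ≠ 0 := fun τ hτ => by
      have := sub_pos.2 (Set.mem_Iio.1 hτ); positivity
    have h3 : ∀ τ ∈ Set.Iio T, 4 * (T - τ + d) ≠ 0 := fun τ hτ => mul_ne_zero four_ne_zero (h2 τ hτ)
    fun_prop (disch := assumption)
  exact h.congr fun τ hτ => singleLayerIntegrand_gaussianDensity hd hτ x

/-! ### Error on one panel and summation over panels -/

theorem integral_sub_gaussLegendre (n : ℕ) (a b : ℝ) (f : ℝ → ℝ) :
    (∫ τ in a..b, f τ) - gaussLegendre n a b f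
      = (b - a) * gaussError n (fun u => f (a + (b - a) * u)) := by
  have h := intervalIntegral.smul_integral_comp_add_mul (a := 0) (b := 1) f (b - a) a
  rw [mul_zero, add_zero, mul_one, add_sub_cancel, smul_eq_mul] at h
  rw [← h, gaussLegendre, gaussError, mul_sub]

/-- The Gauss-Legendre error of the time integrand on `[T - 2 h, T - h]`, uniformly in `h`. -/
theorem abs_integral_sub_gaussLegendre_le {d h : ℝ} (hd : 0 < d) (hh : 0 < h) {n : ℕ} (hn : 1 ≤ n)
    (x T : ℝ) :
    |(∫ τ in (T - 2 * h)..(T - h), singleLayerIntegrand (gaussianDensity d) (axisPoint x) T τ)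
        - gaussLegendre n (T - 2 * h) (T - h)
            (singleLayerIntegrand (gaussianDensity d) (axisPoint x) T)|
      ≤ (1 / 17) ^ n := by
  have hlen : T - h - (T - 2 * h) = h := by ring
  rw [integral_sub_gaussLegendre, hlen]
  have h1 : ∀ u ∈ Set.Icc (0 : ℝ) 1,
      singleLayerIntegrand (gaussianDensity d) (axisPoint x) T (T - 2 * h + h * u)
        = 1 / (4 * Real.pi ^ 2) * ∫ z : ℝ × ℝ, (Real.cos (x * z.2) * Real.exp (-d * z.2 ^ 2))
          * Real.exp (-((z.1 ^ 2 + z.2 ^ 2) * h * (2 - u))) := by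
    intro u hu
    rw [singleLayerIntegrand_eq_laplace hd (by nlinarith [hu.2]),
      show T - (T - 2 * h + h * u) = h * (2 - u) by ring]
    simp only [← mul_assoc]
  have h2 : ∀ u ∈ Set.Icc (0 : ℝ) 1,
      ∫ z : ℝ × ℝ, Real.exp (-((z.1 ^ 2 + z.2 ^ 2) * h * (2 - u)))
        = Real.pi / h * (2 - u)⁻¹ := by
    intro u hu
    simp only [mul_assoc]
    rw [integral_prod_exp_neg (mul_pos hh (by linarith [hu.2]))]
    rw [← div_div, div_eq_mul_inv (Real.pi / h)]
  -- All dependence on `d` and `x` sits in `W`, so it disappears from the upper bound. The factor `1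
  -- / h` there cancels the panel length.
  have h3 := abs_gaussError_integral_laplace_le n (μ := (volume : Measure (ℝ × ℝ)))
    (W := fun z => Real.cos (x * z.2) * Real.exp (-d * z.2 ^ 2))
    (ρ := fun z => (z.1 ^ 2 + z.2 ^ 2) * h) (by fun_prop) (fun z => by
      rw [abs_mul, Real.abs_exp]
      exact mul_le_one₀ (Real.abs_cos_le_one _) (Real.exp_pos _).le
        (Real.exp_le_one_iff.2 (by nlinarith [sq_nonneg z.2])))
    (by fun_prop) (fun z => by positivity) (integrable_prod_exp_neg hh)
  rw [gaussError_congr h2, gaussError_const_mul] at h3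
  rw [gaussError_congr h1, gaussError_const_mul, abs_mul, abs_mul, abs_of_pos hh,
    abs_of_pos (by positivity)]
  have h4 := gaussError_inv_le hn
  have hπ := Real.pi_gt_three
  calc h * (1 / (4 * Real.pi ^ 2) * _)
      ≤ h * (1 / (4 * Real.pi ^ 2) * (Real.pi / h * (2 * (1 / 17) ^ n))) := by
        gcongr
        exact h3.trans (by gcongr)
    _ = 1 / (2 * Real.pi) * (1 / 17) ^ n := by field_simp; norm_num
    _ ≤ 1 * (1 / 17) ^ n := by
        gcongr
        rw [div_le_one (by positivity)]
        linarith
    _ = (1 / 17) ^ n := one_mul _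

theorem truncatedSingleLayer_eq_sum {d ε T : ℝ} (hd : 0 < d) (hε : 0 < ε) {N : ℕ}
    (hT : T = 2 ^ N * ε ^ 2) (x : ℝ) :
    truncatedSingleLayer (gaussianDensity d) ε (axisPoint x) T
      = ∑ i ∈ Finset.range N, ∫ τ in (T - 2 ^ (i + 1) * ε ^ 2)..(T - 2 ^ i * ε ^ 2),
          singleLayerIntegrand (gaussianDensity d) (axisPoint x) T τ := by
  have hii : ∀ i, IntervalIntegrable (singleLayerIntegrand (gaussianDensity d) (axisPoint x) T)
      volume (T - 2 ^ i * ε ^ 2) (T - 2 ^ (i + 1) * ε ^ 2) := by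
    intro i
    refine ((continuousOn_singleLayerIntegrand hd x T).mono ?_).intervalIntegrable
    refine Set.ordConnected_Iio.uIcc_subset ?_ ?_ <;>
    · rw [Set.mem_Iio, sub_lt_self_iff]
      positivity
  -- These endpoints decrease from `T - ε ^ 2` to `T - 2 ^ N * ε ^ 2 = 0`, hence the sign reversals
  -- below.
  have h := intervalIntegral.sum_integral_adjacent_intervals (a := fun i => T - 2 ^ i * ε ^ 2)
    (n := N) (fun k _ => hii k)
  simp only [pow_zero, one_mul] at h
  rw [← hT, sub_self] at h
  rw [truncatedSingleLayer, intervalIntegral.integral_symm, ← h, ← Finset.sum_neg_distrib]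
  exact Finset.sum_congr rfl fun i _ => (intervalIntegral.integral_symm _ _).symm

end HeatQuad

end

theorem theorem3p1 :
    ∃ C : ℝ, 0 < C ∧
      ∀ (d ε Δt : ℝ) (N n : ℕ), 0 < d → 0 < ε → Δt = 2 ^ N * ε ^ 2 → 1 ≤ n →
        ∀ x : ℝ,
          |HeatQuad.truncatedSingleLayer (HeatQuad.gaussianDensity d) ε
                (HeatQuad.axisPoint x) Δt
              - HeatQuad.dyadicGaussLegendre n N ε Δt
                  (HeatQuad.singleLayerIntegrand (HeatQuad.gaussianDensity d)
                    (HeatQuad.axisPoint x) Δt)|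
            ≤ C * Real.logb 2 (Δt / ε ^ 2) * ((n : ℝ) ^ (1 / 4 : ℝ) / 16 ^ n) := by
  refine ⟨1, one_pos, fun d ε Δt N n hd hε hT hn x => ?_⟩
  have hlog : Real.logb 2 (Δt / ε ^ 2) = N := by
    rw [hT, mul_div_cancel_right₀ _ (by positivity), Real.logb_pow, Real.logb_self_eq_one
      one_lt_two, mul_one]
  -- Since `17 > 16` and `n ^ (1 / 4) ≥ 1`, the constant `C = 1` suffices.
  have hrate : (1 / 17 : ℝ) ^ n ≤ (n : ℝ) ^ (1 / 4 : ℝ) / 16 ^ n := by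
    have hn1 : (1 : ℝ) ≤ (n : ℝ) ^ (1 / 4 : ℝ) :=
      Real.one_le_rpow (by exact_mod_cast hn) (by norm_num)
    calc (1 / 17 : ℝ) ^ n ≤ (1 / 16) ^ n := by gcongr; norm_num
      _ = 1 / 16 ^ n := by rw [one_div_pow]
      _ ≤ _ := by gcongr
  rw [HeatQuad.truncatedSingleLayer_eq_sum hd hε hT, HeatQuad.dyadicGaussLegendre,
    ← Finset.sum_sub_distrib, hlog, one_mul]
  calc _ ≤ ∑ i ∈ Finset.range N, (n : ℝ) ^ (1 / 4 : ℝ) / 16 ^ n := by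
        refine (Finset.abs_sum_le_sum_abs _ _).trans (Finset.sum_le_sum fun i _ => ?_)
        have h := HeatQuad.abs_integral_sub_gaussLegendre_le hd
          (show 0 < 2 ^ i * ε ^ 2 by positivity) hn x Δt
        rw [← mul_assoc, ← pow_succ'] at h
        exact h.trans hrate
    _ = _ := by rw [Finset.sum_const, Finset.card_range, nsmul_eq_mul]
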